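/- Let $\lambda,\mu>0$, $0<q<1$, $b\in\mathbb N$, and let $Y$ be a random variable with $P(Y=j)=p_j$ for $j=1,\dots,b$, $\sum_{j=1}^b p_j=1$; write $\phi_Y(x)=\sum_{j=1}^b p_jx^j$. The homogeneous $\mathrm{Cox}(\infty)/M^Y/1$ queue is the continuous-time Markov chain on $\{(m,i): m,i\in\{0,1,2,\dots\}\}$ ($m$ customers present, $i$ completed arrival phases of the next customer) with transition rates $\lambda q$ from $(m,i)$ to $(m,i+1)$, $\lambda(1-q)$ from $(m,i)$ to $(m+1,0)$, and, for $m\ge 1$ and $1\le j\le b$, $\mu p_j$ from $(m,i)$ to $(\max(m-j,0),i)$. Theorem. Suppose that $\lambda(1-q)<\mu\,E[Y]$ (in particular, suppose that $\lambda(1-q)/q<\mu\,E[Y]$). Then the equations $$\alpha=\frac{\lambda}{\lambda+\mu-\mu\phi_Y(\gamma)},\qquad \gamma=\frac{\alpha(1-q)}{1-q\alpha}$$ have exactly one solution $(\gamma,\alpha)$ with $0<\gamma<1$; the queue has exactly one stationary distribution $\pi$; and $\pi$ is given by $$\pi_{(m,i)}=\pi_{(0,0)}\,\frac{\lambda(1-\gamma)\gamma^{m-1}}{\mu(1-\phi_Y(\gamma))}\,(q\alpha)^i\qquad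 (m\ge 1,\ i\ge 0),$$ $$\pi_{(0,i)}=\pi_{(0,0)}\,q^i\Bigl(1+\sum_{j=1}^i\alpha^j\Bigr)\qquad (i\ge 1),\qquad \pi_{(0,0)}=(1-q)(1-\alpha).$$ -/

import Mathlib

noncomputable section

namespace CoxQueue

/-- State `(m, i)`: there are `m` customers in the system and the arrival process of the next
customer has completed `i` phases; `m` and `i` range over all natural numbers. -/
abbrev State : Type := ℕ × ℕ

/-- The probability generating function `φ_Y(x) = ∑_{j=1}^b p_j x^j` of the batch size `Y`. -/
def pgf (b : ℕ) (p : ℕ → ℝ) (x : ℝ) : ℝ := ∑ j ∈ Finset.Icc 1 b, p j * x ^ j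

/-- The mean batch size `E[Y] = ∑_{j=1}^b j p_j`. -/
def meanBatch (b : ℕ) (p : ℕ → ℝ) : ℝ := ∑ j ∈ Finset.Icc 1 b, (j : ℝ) * p j

/-- The infinitesimal generator, acting on functions. From `(m, i)` the process jumps to
`(m, i + 1)` at rate `lam * q` (a new phase starts), to `(m + 1, 0)` at rate `lam * (1 - q)`
(an arrival), and to `(max (m - j) 0, i)` at rate `mu * p j` for `1 ≤ j ≤ b` (a batch service).
The subtraction `m - j` is truncated, so that a batch larger than the number of customers present
empties the system, and for `m = 0` the service terms vanish. -/
def genFun (lam mu q : ℝ) (b : ℕ) (p : ℕ → ℝ) (f : State → ℝ) (x : State) : ℝ :=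
  lam * q * (f (x.1, x.2 + 1) - f x) + lam * (1 - q) * (f (x.1 + 1, 0) - f x)
    + ∑ j ∈ Finset.Icc 1 b, mu * p j * (f (x.1 - j, x.2) - f x)

/-- The transition probabilities `P_t(x, y)` of the queueing process, the continuous-time Markov
chain with the above generator `G`. The jump rates are bounded, so the transition function is the
exponential `P_t = exp (t G)`, that is `P_t(x, y) = ∑_n (t ^ n / n!) (G ^ n 1_y)(x)`. -/
def transProb (lam mu q : ℝ) (b : ℕ) (p : ℕ → ℝ) (t : ℝ) (x y : State) : ℝ :=
  ∑' n : ℕ, t ^ n / (n.factorial : ℝ) *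
    (genFun lam mu q b p)^[n] (fun z => if z = y then 1 else 0) x

/-- A bound for the operator norm of the generator on bounded functions (twice the total rate). -/
def genBound (lam mu q : ℝ) (b : ℕ) (p : ℕ → ℝ) : ℝ :=
  2 * |lam * q| + 2 * |lam * (1 - q)| + ∑ j ∈ Finset.Icc 1 b, 2 * |mu * p j|

theorem abs_genFun_le (lam mu q : ℝ) (b : ℕ) (p : ℕ → ℝ) (f : State → ℝ) (C : ℝ)
    (hf : ∀ x, |f x| ≤ C) (x : State) :
    |genFun lam mu q b p f x| ≤ genBound lam mu q b p * C := by
  have key : ∀ (c : ℝ) (y : State), |c * (f y - f x)| ≤ 2 * |c| * C := by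
    intro c y
    have h : |f y - f x| ≤ 2 * C := by
      have h3 := abs_sub (f y) (f x)
      linarith [hf x, hf y]
    rw [abs_mul]
    nlinarith [abs_nonneg c]
  unfold genFun genBound
  rw [add_mul, add_mul, Finset.sum_mul]
  refine (abs_add_le _ _).trans (add_le_add ((abs_add_le _ _).trans (add_le_add ?_ ?_)) ?_)
  · exact key _ _
  · exact key _ _
  · exact (Finset.abs_sum_le_sum_abs _ _).trans (Finset.sum_le_sum fun j _ => key _ _)

theorem abs_iterate_genFun_le (lam mu q : ℝ) (b : ℕ) (p : ℕ → ℝ) (y : State) (n : ℕ) :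
    ∀ x, |(genFun lam mu q b p)^[n] (fun z => if z = y then 1 else 0) x|
      ≤ genBound lam mu q b p ^ n := by
  induction n with
  | zero =>
    intro x
    simp only [Function.iterate_zero, id_eq, pow_zero]
    split_ifs <;> simp
  | succ n ih =>
    intro x
    rw [Function.iterate_succ_apply', pow_succ']
    exact abs_genFun_le lam mu q b p _ _ ih x

/-- The exponential series that defines the transition probabilities converges. -/
theorem summable_transProb (lam mu q : ℝ) (b : ℕ) (p : ℕ → ℝ) (t : ℝ) (x y : State) :
    Summable fun n : ℕ => t ^ n / (n.factorial : ℝ) *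
      (genFun lam mu q b p)^[n] (fun z => if z = y then 1 else 0) x := by
  refine Summable.of_norm_bounded
    (Real.summable_pow_div_factorial (|t| * genBound lam mu q b p)) fun n => ?_
  have h := abs_iterate_genFun_le lam mu q b p y n x
  rw [Real.norm_eq_abs, abs_mul, abs_div, abs_pow, Nat.abs_cast, mul_pow, mul_div_right_comm]
  exact mul_le_mul_of_nonneg_left h (by positivity)

/-- `π` is a stationary distribution of the `Cox(∞)/M^Y/1` queue with homogeneous phase rate `lam`,
continuation probability `q`, service rate `mu` and batch size probabilities `p 1, …, p b`:
a probability distribution with `π P_t = π` for all `t ≥ 0`. -/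
def IsStationary (lam mu q : ℝ) (b : ℕ) (p : ℕ → ℝ) (π : State → ℝ) : Prop :=
  (∀ x, 0 ≤ π x) ∧ HasSum π 1 ∧
    ∀ t : ℝ, 0 ≤ t → ∀ y, HasSum (fun x => π x * transProb lam mu q b p t x y) (π y)

/-- The equations `α = λ / (λ + μ - μ φ_Y(γ))` and `γ = α (1 - q) / (1 - q α)` with `0 < γ < 1`. -/
def IsFactorPair (lam mu q : ℝ) (b : ℕ) (p : ℕ → ℝ) (γ α : ℝ) : Prop :=
  0 < γ ∧ γ < 1 ∧ α = lam / (lam + mu - mu * pgf b p γ) ∧ γ = α * (1 - q) / (1 - q * α)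

end CoxQueue

end

/-!
The generator `G` acts boundedly on bounded functions, so a summable `π` satisfies `π P_t = π` for
all `t ≥ 0` if and only if `π G = 0`, that is, `π` solves the global balance equations.

Uniqueness: if `u` is a signed summable solution of the balance equations, then so is `|u|`, because
the inflow of `|u|` dominates its outflow at every state while both have the same total. Hence
`|u| ± u` are nonnegative solutions, and positivity of such a solution propagates along the
transitions. Since the empty state can be reached from everywhere, `u` has constant sign, and the
difference of two stationary distributions vanishes.

Existence: let `T(x) = (1 - φ_Y(x)) / (1 - x) = ∑_k P(Y > k) x ^ k`. On `0 < γ < 1` the equations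
for `(γ, α)` say that `α = γ / (1 - q + q γ)` and `μ γ T(γ) = λ (1 - q)`. The left-hand side of the
latter increases from `0` at `γ = 0` to `μ E[Y]` at `γ = 1`, so there is exactly one root, and the
corresponding product form is checked to satisfy the balance equations.
-/

noncomputable section

namespace CoxQueue

open scoped ENNReal lp

section Semigroup

variable {E F : Type*} [NormedAddCommGroup E] [NormedSpace ℝ E] [CompleteSpace E]
  [NormedAddCommGroup F] [NormedSpace ℝ F] {A : E →L[ℝ] E} {L : E →L[ℝ] F}

theorem hasDerivAt_apply_exp_smul (A : E →L[ℝ] E) (L : E →L[ℝ] F) (x : E) (t : ℝ) :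
    HasDerivAt (fun s : ℝ => L (NormedSpace.exp (s • A) x))
      (L (A (NormedSpace.exp (t • A) x))) t :=
  (L ∘L ContinuousLinearMap.apply ℝ E x).hasFDerivAt.comp_hasDerivAt t
    (hasDerivAt_exp_smul_const' A t)

theorem apply_exp_smul_eq_of_apply_eq_zero (h : ∀ x, L (A x) = 0) (t : ℝ) (x : E) :
    L (NormedSpace.exp (t • A) x) = L x := by
  have hderiv := hasDerivAt_apply_exp_smul A L x
  have hconst := is_const_of_deriv_eq_zero (fun t => (hderiv t).differentiableAt)
    (fun t => (hderiv t).deriv.trans (h _)) t 0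
  simpa using hconst

theorem apply_eq_zero_of_apply_exp_smul_eq {x : E}
    (h : ∀ t : ℝ, 0 ≤ t → L (NormedSpace.exp (t • A) x) = L x) : L (A x) = 0 := by
  have hderiv : HasDerivWithinAt (fun t : ℝ => L (NormedSpace.exp (t • A) x)) (L (A x))
      (Set.Ici 0) 0 := by
    simpa using (hasDerivAt_apply_exp_smul A L x 0).hasDerivWithinAt (s := Set.Ici 0)
  have hzero : HasDerivWithinAt (fun t : ℝ => L (NormedSpace.exp (t • A) x)) 0 (Set.Ici 0) 0 :=
    (hasDerivWithinAt_const 0 _ (L x)).congr h (h 0 le_rfl)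
  exact (uniqueDiffOn_Ici (0 : ℝ) 0 Set.self_mem_Ici).eq_deriv _ hderiv hzero

theorem hasSum_apply_exp_smul (A : E →L[ℝ] E) (L : E →L[ℝ] F) (t : ℝ) (x : E) :
    HasSum (fun n : ℕ => (t ^ n / (n.factorial : ℝ)) • L (A^[n] x))
      (L (NormedSpace.exp (t • A) x)) := by
  have hexp := NormedSpace.exp_series_hasSum_exp' (𝕂 := ℝ) (t • A)
  refine ((L ∘L ContinuousLinearMap.apply ℝ E x).hasSum hexp).congr_fun fun n => ?_
  simp [smul_pow, div_eq_inv_mul, mul_smul]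

end Semigroup

section Pushforward

variable {X Y : Type*} {u v : X → ℝ}

/-- The image of the weight `u` under the map `τ`, as for measures. The sums over the fibres are
junk unless `u` is summable. -/
def pushforward (τ : X → Y) (u : X → ℝ) (y : Y) : ℝ := ∑' x : τ ⁻¹' {y}, u x

theorem hasSum_pushforward (τ : X → Y) {a : ℝ} (hu : HasSum u a) : HasSum (pushforward τ u) a :=
  hu.tsum_fiberwise τ

theorem pushforward_add (τ : X → Y) (hu : Summable u) (hv : Summable v) :
    pushforward τ (u + v) = pushforward τ u + pushforward τ v :=
  funext fun y => (hu.subtype (τ ⁻¹' {y})).tsum_add (hv.subtype (τ ⁻¹' {y}))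

theorem pushforward_neg (τ : X → Y) : pushforward τ (-u) = -pushforward τ u :=
  funext fun _ => tsum_neg

theorem abs_pushforward_le (τ : X → Y) (hu : Summable u) (y : Y) :
    |pushforward τ u y| ≤ pushforward τ |u| y := by
  have hfiber : Summable fun x : τ ⁻¹' {y} => ‖u x‖ := hu.abs.subtype (τ ⁻¹' {y})
  exact norm_tsum_le_tsum_norm hfiber

theorem pushforward_nonneg (τ : X → Y) (hu : 0 ≤ u) : 0 ≤ pushforward τ u :=
  fun _ => tsum_nonneg fun x => hu x

theorem le_pushforward_apply (τ : X → Y) (hu : Summable u) (hu0 : 0 ≤ u) (x : X) :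
    u x ≤ pushforward τ u (τ x) := by
  have hfiber : Summable fun z : τ ⁻¹' {τ x} => u z := hu.subtype (τ ⁻¹' {τ x})
  exact hfiber.le_tsum ⟨x, rfl⟩ fun z _ => hu0 z

theorem pushforward_eq_tsum {Z : Type*} {τ : X → Y} {y : Y} {e : Z → X}
    (he : Function.Injective e) (h : ∀ x, τ x = y ↔ x ∈ Set.range e) :
    pushforward τ u y = ∑' z, u (e z) := by
  rw [pushforward, show τ ⁻¹' {y} = Set.range e from Set.ext h, tsum_range u he]

theorem pushforward_eq_sum {τ : X → Y} {y : Y} {s : Finset X} (h : ∀ x, τ x = y ↔ x ∈ s) :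
    pushforward τ u y = ∑ x ∈ s, u x := by
  rw [pushforward, show τ ⁻¹' {y} = s from Set.ext h, Finset.tsum_subtype']

end Pushforward

section Pairing

variable {X : Type*} {u : X → ℝ}

/-- The functional `f ↦ ∑ₓ u x * f x` that a summable weight `u` defines on bounded functions. It is
the sum of a series of functionals, hence junk unless `u` is summable. -/
def pairing (u : X → ℝ) : ℓ^∞(X, ℝ) →L[ℝ] ℝ := ∑' x, u x • lp.evalCLM ℝ (fun _ => ℝ) ∞ x

theorem norm_evalCLM_le (x : X) : ‖lp.evalCLM ℝ (fun _ : X => ℝ) ∞ x‖ ≤ 1 :=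
  ContinuousLinearMap.opNorm_le_bound _ zero_le_one fun f => by
    rw [one_mul]
    exact lp.norm_apply_le_norm ENNReal.top_ne_zero f x

theorem hasSum_pairing (hu : Summable u) (f : ℓ^∞(X, ℝ)) :
    HasSum (fun x => u x * f x) (pairing u f) := by
  have hsum : Summable fun x => u x • lp.evalCLM ℝ (fun _ : X => ℝ) ∞ x :=
    .of_norm_bounded hu.abs fun x => by
      rw [norm_smul]
      exact mul_le_of_le_one_right (abs_nonneg _) (norm_evalCLM_le x)
  exact hsum.hasSum.mapL (ContinuousLinearMap.apply ℝ ℝ f)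

theorem hasSum_mul_single [DecidableEq X] (g : X → ℝ) (y : X) :
    HasSum (fun x => g x * lp.single (E := fun _ => ℝ) ∞ y 1 x) (g y) := by
  have h := hasSum_single (f := fun x => g x * lp.single (E := fun _ => ℝ) ∞ y 1 x) y
    fun x hx => by rw [lp.single_apply_ne ∞ y _ hx, mul_zero]
  rwa [lp.single_apply_self, mul_one] at h

theorem pairing_single [DecidableEq X] (hu : Summable u) (y : X) :
    pairing u (lp.single ∞ y 1) = u y :=
  (hasSum_pairing hu _).unique (hasSum_mul_single u y)

/-- The composition operator `f ↦ f ∘ τ` on bounded functions. -/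
def compCLM (τ : X → X) : ℓ^∞(X, ℝ) →L[ℝ] ℓ^∞(X, ℝ) :=
  LinearMap.mkContinuous
    { toFun f := ⟨f ∘ τ, memℓp_infty
        ((memℓp_infty_iff.1 f.2).mono (Set.range_comp_subset_range τ fun x => ‖f x‖))⟩
      map_add' _ _ := rfl
      map_smul' _ _ := rfl } 1
    fun f => lp.norm_le_of_forall_le (by positivity) fun x => by
      rw [one_mul]
      exact lp.norm_apply_le_norm ENNReal.top_ne_zero f (τ x)

theorem hasSum_pushforward_mul (hu : Summable u) (τ : X → X) (f : ℓ^∞(X, ℝ)) :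
    HasSum (fun y => pushforward τ u y * f y) (pairing u (compCLM τ f)) := by
  refine (hasSum_pushforward τ (hasSum_pairing hu (compCLM τ f))).congr_fun fun y => ?_
  rw [pushforward, pushforward, ← tsum_mul_right]
  exact tsum_congr fun x => congrArg (u x * f ·) x.2.symm

end Pairing

/-- A continuous-time chain on `X` that makes the deterministic move `move k` at rate `rate k`,
whatever its state. The rates are arbitrary reals. -/
structure JumpChain (X ι : Type*) where
  /-- The rate of each kind of move. -/
  rate : ι → ℝ
  /-- The effect of each kind of move. -/
  move : ι → X → X

namespace JumpChain

variable {X ι : Type*} [Fintype ι] (C : JumpChain X ι) {u v : X → ℝ}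

/-- The total jump rate, moves that do not change the state included. -/
def totalRate : ℝ := ∑ k, C.rate k

/-- The rate at which mass distributed according to `u` flows into a state, moves that do not change
the state included. -/
def inflow (u : X → ℝ) (y : X) : ℝ := ∑ k, C.rate k * pushforward (C.move k) u y

/-- The global balance equations. -/
def IsBalanced (u : X → ℝ) : Prop := ∀ y, C.inflow u y = C.totalRate * u y

/-- The one-step transition relation of the chain. -/
def Step (x y : X) : Prop := ∃ k, 0 < C.rate k ∧ C.move k x = y

section Stationarity

/-- The infinitesimal generator of the chain, as an operator on bounded functions. -/
def generator : ℓ^∞(X, ℝ) →L[ℝ] ℓ^∞(X, ℝ) := ∑ k, C.rate k • (compCLM (C.move k) - 1)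

theorem generator_apply (f : ℓ^∞(X, ℝ)) (x : X) :
    C.generator f x = ∑ k, C.rate k * (f (C.move k x) - f x) := by
  rw [generator, sum_apply, lp.coeFn_sum]
  exact Finset.sum_apply (M := fun _ => ℝ) x _ _

theorem hasSum_pairing_generator (hu : Summable u) (f : ℓ^∞(X, ℝ)) :
    HasSum (fun y => (C.inflow u y - C.totalRate * u y) * f y) (pairing u (C.generator f)) := by
  have hmoves := hasSum_sum (s := Finset.univ) fun k _ =>
    ((hasSum_pushforward_mul hu (C.move k) f).sub (hasSum_pairing hu f)).mul_left (C.rate k)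
  have hlimit : pairing u (C.generator f)
      = ∑ k, C.rate k * (pairing u (compCLM (C.move k) f) - pairing u f) := by
    simp [generator]
  rw [hlimit]
  refine hmoves.congr_fun fun y => ?_
  simp only [inflow, totalRate, Finset.sum_mul, ← Finset.sum_sub_distrib]
  exact Finset.sum_congr rfl fun k _ => by ring

theorem pairing_generator_single [DecidableEq X] (hu : Summable u) (y : X) :
    pairing u (C.generator (lp.single ∞ y 1)) = C.inflow u y - C.totalRate * u y :=
  (C.hasSum_pairing_generator hu _).unique (hasSum_mul_single _ y)

variable {C}

theorem IsBalanced.pairing_generator (h : C.IsBalanced u) (hu : Summable u) (f : ℓ^∞(X, ℝ)) :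
    pairing u (C.generator f) = 0 := by
  have hsum := C.hasSum_pairing_generator hu f
  simp only [h _, sub_self, zero_mul] at hsum
  exact hsum.unique hasSum_zero

theorem isBalanced_iff_pairing_exp [DecidableEq X] (hu : Summable u) :
    C.IsBalanced u ↔ ∀ t : ℝ, 0 ≤ t → ∀ y,
      pairing u (NormedSpace.exp (t • C.generator) (lp.single ∞ y 1)) = u y := by
  constructor
  · intro h t _ y
    rw [apply_exp_smul_eq_of_apply_eq_zero (h.pairing_generator hu), pairing_single hu]
  · intro h y
    have hzero := apply_eq_zero_of_apply_exp_smul_eq fun t ht =>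
      (h t ht y).trans (pairing_single hu y).symm
    rwa [C.pairing_generator_single hu, sub_eq_zero] at hzero

end Stationarity

section Uniqueness

theorem hasSum_inflow (hu : Summable u) : HasSum (C.inflow u) (C.totalRate * ∑' x, u x) := by
  rw [totalRate, Finset.sum_mul]
  exact hasSum_sum fun k _ => (hasSum_pushforward (C.move k) hu.hasSum).mul_left (C.rate k)

theorem inflow_add (hu : Summable u) (hv : Summable v) :
    C.inflow (u + v) = C.inflow u + C.inflow v := by
  funext y
  simp only [inflow, pushforward_add _ hu hv, Pi.add_apply, mul_add, Finset.sum_add_distrib]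

theorem inflow_neg : C.inflow (-u) = -C.inflow u := by
  funext y
  simp only [inflow, pushforward_neg, Pi.neg_apply, mul_neg, Finset.sum_neg_distrib]

variable {C}

theorem IsBalanced.add (h : C.IsBalanced u) (h' : C.IsBalanced v) (hu : Summable u)
    (hv : Summable v) : C.IsBalanced (u + v) := fun y => by
  rw [C.inflow_add hu hv, Pi.add_apply, h, h', Pi.add_apply, mul_add]

theorem IsBalanced.neg (h : C.IsBalanced u) : C.IsBalanced (-u) := fun y => by
  rw [C.inflow_neg, Pi.neg_apply, h, Pi.neg_apply, mul_neg]

theorem totalRate_nonneg (hC : ∀ k, 0 ≤ C.rate k) : 0 ≤ C.totalRate :=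
  Finset.sum_nonneg fun k _ => hC k

theorem abs_inflow_le (hC : ∀ k, 0 ≤ C.rate k) (hu : Summable u) (y : X) :
    |C.inflow u y| ≤ C.inflow |u| y := by
  refine (Finset.abs_sum_le_sum_abs _ _).trans (Finset.sum_le_sum fun k _ => ?_)
  rw [abs_mul, abs_of_nonneg (hC k)]
  exact mul_le_mul_of_nonneg_left (abs_pushforward_le _ hu y) (hC k)

theorem IsBalanced.abs (h : C.IsBalanced u) (hC : ∀ k, 0 ≤ C.rate k) (hu : Summable u) :
    C.IsBalanced |u| := by
  have hexcess_nonneg : ∀ y, 0 ≤ C.inflow |u| y - C.totalRate * |u| y := fun y => by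
    rw [sub_nonneg, Pi.abs_apply, ← abs_of_nonneg (totalRate_nonneg hC), ← abs_mul, ← h y]
    exact abs_inflow_le hC hu y
  have hexcess_sum := (C.hasSum_inflow hu.abs).sub (hu.abs.hasSum.mul_left C.totalRate)
  rw [sub_self] at hexcess_sum
  have hexcess := (hasSum_zero_iff_of_nonneg hexcess_nonneg).1 hexcess_sum
  exact fun y => sub_eq_zero.1 (congrFun hexcess y)

theorem rate_mul_le_inflow (hC : ∀ k, 0 ≤ C.rate k) (hu : Summable u) (hu0 : 0 ≤ u) (k : ι)
    (x : X) : C.rate k * u x ≤ C.inflow u (C.move k x) :=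
  (mul_le_mul_of_nonneg_left (le_pushforward_apply _ hu hu0 x) (hC k)).trans
    (Finset.single_le_sum (f := fun l => C.rate l * pushforward (C.move l) u (C.move k x))
      (fun l _ => mul_nonneg (hC l) (pushforward_nonneg _ hu0 _)) (Finset.mem_univ k))

theorem IsBalanced.pos_of_step_of_nonneg (h : C.IsBalanced u) (hC : ∀ k, 0 ≤ C.rate k)
    (hu : Summable u) (hu0 : 0 ≤ u) {x y : X} (hxy : C.Step x y) (hx : 0 < u x) : 0 < u y := by
  obtain ⟨k, hk, rfl⟩ := hxy
  have hinflow := (mul_pos hk hx).trans_le (rate_mul_le_inflow hC hu hu0 k x)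
  rw [h] at hinflow
  exact pos_of_mul_pos_right hinflow (totalRate_nonneg hC)

theorem IsBalanced.pos_of_step (h : C.IsBalanced u) (hC : ∀ k, 0 ≤ C.rate k) (hu : Summable u)
    {x y : X} (hxy : C.Step x y) (hx : 0 < u x) : 0 < u y := by
  have hpos : 0 < |u y| + u y :=
    ((h.abs hC hu).add h hu.abs hu).pos_of_step_of_nonneg hC (hu.abs.add hu)
      (fun z => neg_le_iff_add_nonneg'.1 (neg_abs_le (u z)))
      hxy (add_pos_of_nonneg_of_pos (abs_nonneg (u x)) hx)
  by_contra! hy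
  rw [abs_of_nonpos hy, neg_add_cancel] at hpos
  exact hpos.false

theorem IsBalanced.pos_of_reflTransGen (h : C.IsBalanced u) (hC : ∀ k, 0 ≤ C.rate k)
    (hu : Summable u) {x y : X} (hxy : Relation.ReflTransGen C.Step x y) (hx : 0 < u x) :
    0 < u y := by
  induction hxy with
  | refl => exact hx
  | tail _ hstep ih => exact h.pos_of_step hC hu hstep ih

theorem IsBalanced.nonpos_of_reflTransGen (h : C.IsBalanced u) (hC : ∀ k, 0 ≤ C.rate k)
    (hu : Summable u) {o : X} (ho : ∀ x, Relation.ReflTransGen C.Step x o) (huo : u o ≤ 0) :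
    u ≤ 0 := fun x =>
  not_lt.1 fun hx => (h.pos_of_reflTransGen hC hu (ho x) hx).not_ge huo

theorem IsBalanced.eq_zero_of_hasSum_zero (h : C.IsBalanced u) (hC : ∀ k, 0 ≤ C.rate k) {o : X}
    (ho : ∀ x, Relation.ReflTransGen C.Step x o) (hu : HasSum u 0) : u = 0 := by
  have hneg : HasSum (-u) 0 := neg_zero (G := ℝ) ▸ hu.neg
  rcases le_total (u o) 0 with huo | huo
  · have hnonpos : u ≤ 0 := h.nonpos_of_reflTransGen hC hu.summable ho huo
    exact neg_eq_zero.1 ((hasSum_zero_iff_of_nonneg (neg_nonneg.2 hnonpos)).1 hneg)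
  · have hnonneg : -u ≤ 0 :=
      h.neg.nonpos_of_reflTransGen hC hneg.summable ho (neg_nonpos.2 huo)
    exact (hasSum_zero_iff_of_nonneg (neg_nonpos.1 hnonneg)).1 hu

theorem IsBalanced.eq_of_hasSum (h : C.IsBalanced u) (h' : C.IsBalanced v)
    (hC : ∀ k, 0 ≤ C.rate k) {o : X} (ho : ∀ x, Relation.ReflTransGen C.Step x o) {a : ℝ}
    (hu : HasSum u a) (hv : HasSum v a) : u = v := by
  have hdiff : HasSum (u + -v) 0 := add_neg_cancel a ▸ hu.add hv.neg
  exact add_neg_eq_zero.1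
    ((h.add h'.neg hu.summable hv.summable.neg).eq_zero_of_hasSum_zero hC ho hdiff)

end Uniqueness

end JumpChain

section QueueChain

variable {lam mu q : ℝ} {b : ℕ} {p : ℕ → ℝ}

/-- The queue as a `JumpChain`: the events are a phase without arrival (`inl false`), an arrival
(`inl true`), and the service of a batch of size `j` (`inr j`). -/
def queueChain (lam mu q : ℝ) (b : ℕ) (p : ℕ → ℝ) :
    JumpChain State (Bool ⊕ Finset.Icc 1 b) where
  rate
    | .inl false => lam * q
    | .inl true => lam * (1 - q)
    | .inr j => mu * p j
  move
    | .inl false => fun x => (x.1, x.2 + 1)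
    | .inl true => fun x => (x.1 + 1, 0)
    | .inr j => fun x => (x.1 - j, x.2)

theorem genFun_coe (f : ℓ^∞(State, ℝ)) :
    genFun lam mu q b p f = (queueChain lam mu q b p).generator f := by
  funext x
  rw [JumpChain.generator_apply, Fintype.sum_sum_type, Fintype.sum_bool, genFun,
    ← Finset.sum_coe_sort (Finset.Icc 1 b), add_comm (lam * q * _)]
  rfl

theorem transProb_eq_exp (t : ℝ) (x y : State) :
    transProb lam mu q b p t x y =
      NormedSpace.exp (t • (queueChain lam mu q b p).generator) (lp.single ∞ y 1) x := by
  set G := (queueChain lam mu q b p).generator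
  have hsingle : (fun z => if z = y then 1 else 0) = ⇑(lp.single (E := fun _ => ℝ) ∞ y 1) := by
    funext z
    simp [lp.single_apply, Pi.single_apply]
  have hiterate : ∀ n : ℕ, ∀ f : ℓ^∞(State, ℝ), (genFun lam mu q b p)^[n] f = ⇑(G^[n] f) :=
    fun n f => ((show Function.Semiconj (fun f : ℓ^∞(State, ℝ) => ⇑f) G (genFun lam mu q b p)
      from fun f => (genFun_coe f).symm).iterate_right n f).symm
  rw [transProb, hsingle]
  simp only [hiterate]
  exact (hasSum_apply_exp_smul G (lp.evalCLM ℝ (fun _ => ℝ) ∞ x) t _).tsum_eq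

theorem isStationary_iff {π : State → ℝ} :
    IsStationary lam mu q b p π ↔
      (∀ x, 0 ≤ π x) ∧ HasSum π 1 ∧ (queueChain lam mu q b p).IsBalanced π := by
  refine and_congr_right fun _ => and_congr_right fun hsum => ?_
  rw [JumpChain.isBalanced_iff_pairing_exp hsum.summable]
  refine forall₃_congr fun t _ y => ?_
  simp only [transProb_eq_exp]
  exact ⟨fun h => (hasSum_pairing hsum.summable _).unique h,
    fun h => h ▸ hasSum_pairing hsum.summable _⟩

theorem queueChain_rate_nonneg (hlam : 0 ≤ lam) (hmu : 0 ≤ mu) (hq0 : 0 ≤ q) (hq1 : q ≤ 1)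
    (hp : ∀ j ∈ Finset.Icc 1 b, 0 ≤ p j) : ∀ k, 0 ≤ (queueChain lam mu q b p).rate k
  | .inl false => mul_nonneg hlam hq0
  | .inl true => mul_nonneg hlam (sub_nonneg.2 hq1)
  | .inr j => mul_nonneg hmu (hp j j.2)

theorem queueChain_totalRate (hp1 : ∑ j ∈ Finset.Icc 1 b, p j = 1) :
    (queueChain lam mu q b p).totalRate = lam + mu := by
  rw [JumpChain.totalRate, Fintype.sum_sum_type, Fintype.sum_bool]
  simp only [queueChain, ← Finset.mul_sum, Finset.sum_coe_sort, hp1]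
  ring

theorem exists_batch_pos (hp1 : ∑ j ∈ Finset.Icc 1 b, p j = 1) : ∃ j ∈ Finset.Icc 1 b, 0 < p j :=
  Finset.exists_lt_of_sum_lt (by simp [hp1])

theorem reflTransGen_step_empty (hlam : 0 < lam) (hmu : 0 < mu) (hq1 : q < 1)
    (hp1 : ∑ j ∈ Finset.Icc 1 b, p j = 1) (x : State) :
    Relation.ReflTransGen (queueChain lam mu q b p).Step x (0, 0) := by
  obtain ⟨j, hj, hpj⟩ := exists_batch_pos hp1
  have harrival : (queueChain lam mu q b p).Step x (x.1 + 1, 0) :=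
    ⟨.inl true, mul_pos hlam (sub_pos.2 hq1), rfl⟩
  have hservice : ∀ m, (queueChain lam mu q b p).Step (m, 0) (m - j, 0) := fun m =>
    ⟨.inr ⟨j, hj⟩, mul_pos hmu hpj, rfl⟩
  have hempty : ∀ m, Relation.ReflTransGen (queueChain lam mu q b p).Step (m, 0) (0, 0) := by
    intro m
    induction m using Nat.strong_induction_on with
    | _ m ih =>
      rcases m.eq_zero_or_pos with rfl | hm
      · exact .refl
      · exact .head (hservice m) (ih (m - j) (Nat.sub_lt hm (Finset.mem_Icc.1 hj).1))
  exact .head harrival (hempty _)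

theorem IsStationary.unique (hlam : 0 < lam) (hmu : 0 < mu) (hq0 : 0 ≤ q) (hq1 : q < 1)
    (hp : ∀ j ∈ Finset.Icc 1 b, 0 ≤ p j) (hp1 : ∑ j ∈ Finset.Icc 1 b, p j = 1)
    {π π' : State → ℝ} (h : IsStationary lam mu q b p π) (h' : IsStationary lam mu q b p π') :
    π = π' := by
  obtain ⟨-, hsum, hbal⟩ := isStationary_iff.1 h
  obtain ⟨-, hsum', hbal'⟩ := isStationary_iff.1 h'
  exact hbal.eq_of_hasSum hbal' (queueChain_rate_nonneg hlam.le hmu.le hq0 hq1.le hp)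
    (reflTransGen_step_empty hlam hmu hq1 hp1) hsum hsum'

theorem inflow_queueChain (u : State → ℝ) (y : State) :
    (queueChain lam mu q b p).inflow u y =
      lam * q * pushforward (fun x => (x.1, x.2 + 1)) u y
        + lam * (1 - q) * pushforward (fun x => (x.1 + 1, 0)) u y
        + mu * ∑ j ∈ Finset.Icc 1 b, p j * pushforward (fun x => (x.1 - j, x.2)) u y := by
  rw [JumpChain.inflow, Fintype.sum_sum_type, Fintype.sum_bool,
    ← Finset.sum_coe_sort (Finset.Icc 1 b), Finset.mul_sum, add_comm (lam * q * _)]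
  simp only [queueChain, mul_assoc]

theorem pushforward_phase_zero (u : State → ℝ) (m : ℕ) :
    pushforward (fun x : State => (x.1, x.2 + 1)) u (m, 0) = 0 :=
  pushforward_eq_sum (s := ∅) fun x => by simp

theorem pushforward_phase_succ (u : State → ℝ) (m i : ℕ) :
    pushforward (fun x : State => (x.1, x.2 + 1)) u (m, i + 1) = u (m, i) := by
  rw [pushforward_eq_sum (s := {(m, i)}) fun x => by simp [Prod.ext_iff], Finset.sum_singleton]

theorem pushforward_arrival_empty (u : State → ℝ) (i : ℕ) :
    pushforward (fun x : State => (x.1 + 1, 0)) u (0, i) = 0 :=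
  pushforward_eq_sum (s := ∅) fun x => by simp

theorem pushforward_arrival_phase_succ (u : State → ℝ) (m i : ℕ) :
    pushforward (fun x : State => (x.1 + 1, 0)) u (m, i + 1) = 0 :=
  pushforward_eq_sum (s := ∅) fun x => by simp

theorem pushforward_arrival_succ_zero (u : State → ℝ) (m : ℕ) :
    pushforward (fun x : State => (x.1 + 1, 0)) u (m + 1, 0) = ∑' i, u (m, i) :=
  pushforward_eq_tsum (Prod.mk_right_injective m) fun x => by simp [Prod.ext_iff, eq_comm]

theorem pushforward_service_empty (u : State → ℝ) (j i : ℕ) :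
    pushforward (fun x : State => (x.1 - j, x.2)) u (0, i)
      = ∑ k ∈ Finset.range (j + 1), u (k, i) := by
  rw [pushforward_eq_sum (s := (Finset.range (j + 1)).map ⟨_, Prod.mk_left_injective i⟩) fun x => by
    simp [Prod.ext_iff, Nat.sub_eq_zero_iff_le, eq_comm], Finset.sum_map]
  rfl

theorem pushforward_service_succ (u : State → ℝ) (j m i : ℕ) :
    pushforward (fun x : State => (x.1 - j, x.2)) u (m + 1, i) = u (m + 1 + j, i) := by
  rw [pushforward_eq_sum (s := {(m + 1 + j, i)}) fun x => by
    simp only [Prod.ext_iff, Finset.mem_singleton]; omega, Finset.sum_singleton]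

end QueueChain

section FactorPair

variable {lam mu q : ℝ} {b : ℕ} {p : ℕ → ℝ} {γ α γ' α' : ℝ}

/-- The generating function `∑ₖ P(Y > k) x ^ k` of the tails of the batch size, written as a double
sum; it is the polynomial `(1 - φ_Y(x)) / (1 - x)`. -/
def tailPgf (b : ℕ) (p : ℕ → ℝ) (x : ℝ) : ℝ :=
  ∑ j ∈ Finset.Icc 1 b, p j * ∑ k ∈ Finset.range j, x ^ k

theorem one_sub_mul_tailPgf (hp1 : ∑ j ∈ Finset.Icc 1 b, p j = 1) (x : ℝ) :
    (1 - x) * tailPgf b p x = 1 - pgf b p x := by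
  have hterm : ∀ j, (1 - x) * (p j * ∑ k ∈ Finset.range j, x ^ k) = p j - p j * x ^ j := fun j => by
    rw [mul_left_comm, mul_neg_geom_sum, mul_one_sub]
  rw [tailPgf, Finset.mul_sum, Finset.sum_congr rfl fun j _ => hterm j, Finset.sum_sub_distrib, hp1,
    pgf]

theorem tailPgf_one : tailPgf b p 1 = meanBatch b p := by
  simp [tailPgf, meanBatch, mul_comm]

theorem continuous_tailPgf : Continuous (tailPgf b p) := by
  unfold tailPgf
  fun_prop

theorem tailPgf_mono (hp : ∀ j ∈ Finset.Icc 1 b, 0 ≤ p j) {x y : ℝ} (hx : 0 ≤ x) (hxy : x ≤ y) :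
    tailPgf b p x ≤ tailPgf b p y :=
  Finset.sum_le_sum fun j hj => mul_le_mul_of_nonneg_left
    (Finset.sum_le_sum fun _ _ => pow_le_pow_left₀ hx hxy _) (hp j hj)

theorem one_le_geom_sum {x : ℝ} (hx : 0 ≤ x) {n : ℕ} (hn : 0 < n) :
    1 ≤ ∑ k ∈ Finset.range n, x ^ k := by
  simpa using Finset.single_le_sum (f := fun k => x ^ k) (fun k _ => pow_nonneg hx k)
    (Finset.mem_range.2 hn)

theorem one_le_tailPgf (hp : ∀ j ∈ Finset.Icc 1 b, 0 ≤ p j) (hp1 : ∑ j ∈ Finset.Icc 1 b, p j = 1)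
    {x : ℝ} (hx : 0 ≤ x) : 1 ≤ tailPgf b p x :=
  hp1.symm.le.trans <| Finset.sum_le_sum fun j hj =>
    le_mul_of_one_le_right (hp j hj) (one_le_geom_sum hx (Finset.mem_Icc.1 hj).1)

theorem strictMonoOn_mul_tailPgf (hp : ∀ j ∈ Finset.Icc 1 b, 0 ≤ p j)
    (hp1 : ∑ j ∈ Finset.Icc 1 b, p j = 1) :
    StrictMonoOn (fun x => x * tailPgf b p x) (Set.Ici 0) := fun _ hx _ _ hxy =>
  mul_lt_mul hxy (tailPgf_mono hp hx hxy.le) (one_pos.trans_le (one_le_tailPgf hp hp1 hx))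
    (le_trans hx hxy.le)

theorem pgf_lt_one (hp : ∀ j ∈ Finset.Icc 1 b, 0 ≤ p j) (hp1 : ∑ j ∈ Finset.Icc 1 b, p j = 1)
    {x : ℝ} (hx0 : 0 ≤ x) (hx1 : x < 1) : pgf b p x < 1 := by
  rw [← sub_pos, ← one_sub_mul_tailPgf hp1]
  exact mul_pos (sub_pos.2 hx1) (one_pos.trans_le (one_le_tailPgf hp hp1 hx0))

theorem one_sub_add_mul_pos (hq0 : 0 ≤ q) (hq1 : q < 1) (hγ : 0 ≤ γ) : 0 < 1 - q + q * γ :=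
  add_pos_of_pos_of_nonneg (sub_pos.2 hq1) (mul_nonneg hq0 hγ)

namespace IsFactorPair

theorem pos (h : IsFactorPair lam mu q b p γ α) : 0 < γ := h.1

theorem lt_one (h : IsFactorPair lam mu q b p γ α) : γ < 1 := h.2.1

theorem mul_one_sub_add_mul (h : IsFactorPair lam mu q b p γ α) : α * (1 - q + q * γ) = γ := by
  obtain ⟨hγ0, -, -, hγ⟩ := h
  have hden : 1 - q * α ≠ 0 := fun hden => hγ0.ne' (by rw [hγ, hden, div_zero])
  rw [eq_div_iff hden] at hγ
  linear_combination -hγ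

theorem mul_sub_mul_pgf (h : IsFactorPair lam mu q b p γ α) :
    α * (lam + mu - mu * pgf b p γ) = lam := by
  have hα0 : α ≠ 0 := fun hα0 => h.pos.ne' (by rw [← h.mul_one_sub_add_mul, hα0, zero_mul])
  obtain ⟨-, -, hα, -⟩ := h
  have hden : lam + mu - mu * pgf b p γ ≠ 0 := fun hden => hα0 (by rw [hα, hden, div_zero])
  exact (eq_div_iff hden).1 hα

theorem mul_tailPgf (hp1 : ∑ j ∈ Finset.Icc 1 b, p j = 1) (h : IsFactorPair lam mu q b p γ α) :
    mu * (γ * tailPgf b p γ) = lam * (1 - q) := by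
  refine mul_left_cancel₀ (sub_pos.2 h.lt_one).ne' ?_
  linear_combination (1 - q + q * γ) * h.mul_sub_mul_pgf
    - (lam + mu - mu * pgf b p γ) * h.mul_one_sub_add_mul + mu * γ * one_sub_mul_tailPgf hp1 γ

theorem alpha_pos (hq0 : 0 ≤ q) (hq1 : q < 1) (h : IsFactorPair lam mu q b p γ α) : 0 < α :=
  pos_of_mul_pos_left (h.mul_one_sub_add_mul.symm ▸ h.pos) (one_sub_add_mul_pos hq0 hq1 h.pos.le).le

theorem alpha_lt_one (hq0 : 0 ≤ q) (hq1 : q < 1) (h : IsFactorPair lam mu q b p γ α) : α < 1 := by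
  refine lt_of_mul_lt_mul_right ?_ (one_sub_add_mul_pos hq0 hq1 h.pos.le).le
  rw [h.mul_one_sub_add_mul]
  linear_combination mul_pos (sub_pos.2 hq1) (sub_pos.2 h.lt_one)

theorem unique (hmu : 0 < mu) (hq0 : 0 ≤ q) (hq1 : q < 1)
    (hp : ∀ j ∈ Finset.Icc 1 b, 0 ≤ p j) (hp1 : ∑ j ∈ Finset.Icc 1 b, p j = 1)
    (h : IsFactorPair lam mu q b p γ α) (h' : IsFactorPair lam mu q b p γ' α') :
    γ = γ' ∧ α = α' := by
  have htail := mul_left_cancel₀ hmu.ne' ((h.mul_tailPgf hp1).trans (h'.mul_tailPgf hp1).symm)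
  obtain rfl := (strictMonoOn_mul_tailPgf hp hp1).injOn h.pos.le h'.pos.le htail
  exact ⟨rfl, mul_right_cancel₀ (one_sub_add_mul_pos hq0 hq1 h.pos.le).ne'
    (h.mul_one_sub_add_mul.trans h'.mul_one_sub_add_mul.symm)⟩

end IsFactorPair

theorem isFactorPair_of_mul_tailPgf (hlam : 0 < lam) (hmu : 0 < mu) (hq0 : 0 ≤ q) (hq1 : q < 1)
    (hp : ∀ j ∈ Finset.Icc 1 b, 0 ≤ p j) (hp1 : ∑ j ∈ Finset.Icc 1 b, p j = 1) (hγ0 : 0 < γ)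
    (hγ1 : γ < 1) (hγ : mu * (γ * tailPgf b p γ) = lam * (1 - q)) :
    IsFactorPair lam mu q b p γ (γ / (1 - q + q * γ)) := by
  have hE := one_sub_add_mul_pos hq0 hq1 hγ0.le
  have hpgf : 0 < lam + mu - mu * pgf b p γ := by
    linear_combination hlam + mul_pos hmu (sub_pos.2 (pgf_lt_one hp hp1 hγ0.le hγ1))
  refine ⟨hγ0, hγ1, ?_, ?_⟩
  · rw [div_eq_div_iff hE.ne' hpgf.ne']
    linear_combination (1 - γ) * hγ - mu * γ * one_sub_mul_tailPgf hp1 γ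
  · have hden : 1 - q * (γ / (1 - q + q * γ)) = (1 - q) / (1 - q + q * γ) := by
      field_simp
      ring
    rw [hden, div_mul_eq_mul_div, div_div_div_cancel_right₀ hE.ne',
      mul_div_cancel_right₀ _ (sub_pos.2 hq1).ne']

theorem exists_isFactorPair (hlam : 0 < lam) (hmu : 0 < mu) (hq0 : 0 ≤ q) (hq1 : q < 1)
    (hp : ∀ j ∈ Finset.Icc 1 b, 0 ≤ p j) (hp1 : ∑ j ∈ Finset.Icc 1 b, p j = 1)
    (herg : lam * (1 - q) < mu * meanBatch b p) :
    ∃ γ α : ℝ, IsFactorPair lam mu q b p γ α := by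
  have hcont : ContinuousOn (fun x => mu * (x * tailPgf b p x)) (Set.Icc 0 1) :=
    (continuous_const.mul (continuous_id.mul continuous_tailPgf)).continuousOn
  have hmem : lam * (1 - q) ∈ Set.Ioo (mu * (0 * tailPgf b p 0)) (mu * (1 * tailPgf b p 1)) := by
    rw [tailPgf_one, zero_mul, mul_zero, one_mul]
    exact ⟨mul_pos hlam (sub_pos.2 hq1), herg⟩
  obtain ⟨γ, ⟨hγ0, hγ1⟩, hγ⟩ := intermediate_value_Ioo zero_le_one hcont hmem
  exact ⟨γ, _, isFactorPair_of_mul_tailPgf hlam hmu hq0 hq1 hp hp1 hγ0 hγ1 hγ⟩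

end FactorPair

section Inflow

variable {lam mu q : ℝ} {b : ℕ} {p : ℕ → ℝ}

theorem inflow_zero_zero (u : State → ℝ) :
    (queueChain lam mu q b p).inflow u (0, 0)
      = mu * ∑ j ∈ Finset.Icc 1 b, p j * ∑ k ∈ Finset.range (j + 1), u (k, 0) := by
  simp only [inflow_queueChain, pushforward_phase_zero, pushforward_arrival_empty,
    pushforward_service_empty, mul_zero, zero_add]

theorem inflow_zero_succ (u : State → ℝ) (i : ℕ) :
    (queueChain lam mu q b p).inflow u (0, i + 1) = lam * q * u (0, i)
      + mu * ∑ j ∈ Finset.Icc 1 b, p j * ∑ k ∈ Finset.range (j + 1), u (k, i + 1) := by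
  simp only [inflow_queueChain, pushforward_phase_succ, pushforward_arrival_empty,
    pushforward_service_empty, mul_zero, add_zero]

theorem inflow_succ_zero (u : State → ℝ) (m : ℕ) :
    (queueChain lam mu q b p).inflow u (m + 1, 0) = lam * (1 - q) * ∑' i, u (m, i)
      + mu * ∑ j ∈ Finset.Icc 1 b, p j * u (m + 1 + j, 0) := by
  simp only [inflow_queueChain, pushforward_phase_zero, pushforward_arrival_succ_zero,
    pushforward_service_succ, mul_zero, zero_add]

theorem inflow_succ_succ (u : State → ℝ) (m i : ℕ) :
    (queueChain lam mu q b p).inflow u (m + 1, i + 1) = lam * q * u (m + 1, i)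
      + mu * ∑ j ∈ Finset.Icc 1 b, p j * u (m + 1 + j, i + 1) := by
  simp only [inflow_queueChain, pushforward_phase_succ, pushforward_arrival_phase_succ,
    pushforward_service_succ, mul_zero, add_zero]

end Inflow

section ProductForm

variable {lam mu q : ℝ} {b : ℕ} {p : ℕ → ℝ} {γ α : ℝ}

/-- The product form with parameters `γ` and `α`, normalized to total mass one for a factor pair.
Level `0` is written without the factor `1 - α` of `π (0, 0)`, which the geometric sum
`1 + α + ⋯ + α ^ i` absorbs. -/
def productForm (q γ α : ℝ) : State → ℝ
  | (0, i) => (1 - q) * (q ^ i - α * (q * α) ^ i)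
  | (m + 1, i) => (1 - α) * γ ^ (m + 1) * (q * α) ^ i

theorem productForm_zero (i : ℕ) :
    productForm q γ α (0, i) = (1 - q) * (q ^ i - α * (q * α) ^ i) := rfl

theorem productForm_succ (m i : ℕ) :
    productForm q γ α (m + 1, i) = (1 - α) * γ ^ (m + 1) * (q * α) ^ i := rfl

theorem productForm_zero_zero : productForm q γ α (0, 0) = (1 - q) * (1 - α) := by
  simp [productForm_zero]

theorem productForm_zero_eq_geom_sum (i : ℕ) :
    productForm q γ α (0, i) = (1 - q) * (1 - α) * q ^ i * ∑ k ∈ Finset.range (i + 1), α ^ k := by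
  rw [productForm_zero]
  linear_combination -(1 - q) * q ^ i * mul_neg_geom_sum α (i + 1)

theorem productForm_nonneg (hq0 : 0 ≤ q) (hq1 : q ≤ 1) (hα0 : 0 ≤ α) (hα1 : α ≤ 1) (hγ0 : 0 ≤ γ) :
    ∀ x, 0 ≤ productForm q γ α x
  | (0, i) => by
    have := sub_nonneg.2 hq1
    have := sub_nonneg.2 hα1
    rw [productForm_zero_eq_geom_sum]
    positivity
  | (m + 1, i) => by
    have := sub_nonneg.2 hα1
    rw [productForm_succ]
    positivity

theorem hasSum_productForm_level (hq0 : 0 ≤ q) (hq1 : q < 1) (hα0 : 0 ≤ α) (hα1 : α < 1)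
    (hαγ : α * (1 - q + q * γ) = γ) (m : ℕ) :
    HasSum (fun i => productForm q γ α (m, i)) ((1 - γ) * γ ^ m) := by
  have hqα : q * α < 1 := mul_lt_one_of_nonneg_of_lt_one_left hq0 hq1 hα1.le
  have hgeom := hasSum_geometric_of_lt_one (mul_nonneg hq0 hα0) hqα
  have hγ : 1 - γ = (1 - α) * (1 - q * α)⁻¹ := by
    rw [← div_eq_mul_inv, eq_div_iff (sub_pos.2 hqα).ne']
    linear_combination hαγ
  cases m with
  | zero =>
    have hsum := ((hasSum_geometric_of_lt_one hq0 hq1).sub (hgeom.mul_left α)).mul_left (1 - q)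
    have hvalue : (1 - q) * ((1 - q)⁻¹ - α * (1 - q * α)⁻¹) = (1 - γ) * γ ^ 0 := by
      have := (sub_pos.2 hq1).ne'
      have := (sub_pos.2 hqα).ne'
      rw [hγ]
      field_simp
      ring
    exact hvalue ▸ hsum
  | succ m =>
    have hvalue : (1 - α) * γ ^ (m + 1) * (1 - q * α)⁻¹ = (1 - γ) * γ ^ (m + 1) := by
      rw [hγ]
      ring
    exact hvalue ▸ hgeom.mul_left ((1 - α) * γ ^ (m + 1))

theorem hasSum_productForm (hq0 : 0 ≤ q) (hq1 : q < 1) (hα0 : 0 ≤ α) (hα1 : α < 1)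
    (hγ0 : 0 ≤ γ) (hγ1 : γ < 1) (hαγ : α * (1 - q + q * γ) = γ) :
    HasSum (productForm q γ α) 1 := by
  have hlevel := hasSum_productForm_level hq0 hq1 hα0 hα1 hαγ
  have htotal : HasSum (fun m : ℕ => (1 - γ) * γ ^ m) 1 := by
    have hgeom := (hasSum_geometric_of_lt_one hγ0 hγ1).mul_left (1 - γ)
    rwa [mul_inv_cancel₀ (sub_pos.2 hγ1).ne'] at hgeom
  have hsummable : Summable (productForm q γ α) := by
    refine (summable_prod_of_nonneg (productForm_nonneg hq0 hq1.le hα0 hα1.le hγ0)).2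
      ⟨fun m => (hlevel m).summable, ?_⟩
    simpa only [(hlevel _).tsum_eq] using htotal.summable
  exact (hsummable.hasSum.prod_fiberwise hlevel).unique htotal ▸ hsummable.hasSum

theorem sum_mul_productForm_add (m i : ℕ) :
    ∑ j ∈ Finset.Icc 1 b, p j * productForm q γ α (m + 1 + j, i)
      = pgf b p γ * productForm q γ α (m + 1, i) := by
  rw [pgf, Finset.sum_mul]
  refine Finset.sum_congr rfl fun j _ => ?_
  rw [add_right_comm, productForm_succ, productForm_succ]
  ring

theorem sum_range_productForm (j i : ℕ) :
    ∑ k ∈ Finset.range (j + 1), productForm q γ α (k, i)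
      = productForm q γ α (0, i) + (1 - α) * γ * (q * α) ^ i * ∑ k ∈ Finset.range j, γ ^ k := by
  rw [Finset.sum_range_succ', add_comm, Finset.mul_sum]
  refine congrArg _ (Finset.sum_congr rfl fun k _ => ?_)
  rw [productForm_succ]
  ring

theorem sum_mul_sum_range_productForm (hp1 : ∑ j ∈ Finset.Icc 1 b, p j = 1) (i : ℕ) :
    ∑ j ∈ Finset.Icc 1 b, p j * ∑ k ∈ Finset.range (j + 1), productForm q γ α (k, i)
      = productForm q γ α (0, i) + (1 - α) * γ * (q * α) ^ i * tailPgf b p γ := by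
  simp only [sum_range_productForm, mul_add, Finset.sum_add_distrib, ← Finset.sum_mul, hp1, one_mul,
    tailPgf, Finset.mul_sum (Finset.Icc 1 b), mul_left_comm (p _)]

namespace IsFactorPair

theorem isBalanced_productForm (hq0 : 0 ≤ q) (hq1 : q < 1)
    (hp1 : ∑ j ∈ Finset.Icc 1 b, p j = 1) (h : IsFactorPair lam mu q b p γ α) :
    (queueChain lam mu q b p).IsBalanced (productForm q γ α) := by
  have hαγ := h.mul_one_sub_add_mul
  have hα := h.mul_sub_mul_pgf
  have htail := h.mul_tailPgf hp1
  have hlevel := hasSum_productForm_level hq0 hq1 (h.alpha_pos hq0 hq1).le (h.alpha_lt_one hq0 hq1)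
    hαγ
  rintro ⟨_ | m, _ | i⟩ <;> rw [queueChain_totalRate hp1]
  · rw [inflow_zero_zero, sum_mul_sum_range_productForm hp1, productForm_zero]
    linear_combination (1 - α) * htail
  · rw [inflow_zero_succ, sum_mul_sum_range_productForm hp1, productForm_zero, productForm_zero]
    linear_combination (1 - α) * (q * α) ^ (i + 1) * htail
  · rw [inflow_succ_zero, (hlevel m).tsum_eq, sum_mul_productForm_add, productForm_succ]
    linear_combination γ ^ m * ((γ - (1 - q + q * γ)) * hα
      + (lam + mu - mu * pgf b p γ) * hαγ)
  · rw [inflow_succ_succ, sum_mul_productForm_add, productForm_succ, productForm_succ]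
    linear_combination -(1 - α) * γ ^ (m + 1) * q * (q * α) ^ i * hα

theorem isStationary_productForm (hq0 : 0 ≤ q) (hq1 : q < 1)
    (hp1 : ∑ j ∈ Finset.Icc 1 b, p j = 1) (h : IsFactorPair lam mu q b p γ α) :
    IsStationary lam mu q b p (productForm q γ α) := by
  have hα0 := (h.alpha_pos hq0 hq1).le
  have hα1 := h.alpha_lt_one hq0 hq1
  exact isStationary_iff.2 ⟨productForm_nonneg hq0 hq1.le hα0 hα1.le h.pos.le,
    hasSum_productForm hq0 hq1 hα0 hα1 h.pos.le h.lt_one h.mul_one_sub_add_mul,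
    h.isBalanced_productForm hq0 hq1 hp1⟩

theorem productForm_of_pos (hmu : mu ≠ 0) (hp : ∀ j ∈ Finset.Icc 1 b, 0 ≤ p j)
    (hp1 : ∑ j ∈ Finset.Icc 1 b, p j = 1) (h : IsFactorPair lam mu q b p γ α) {m : ℕ} (hm : 1 ≤ m)
    (i : ℕ) :
    productForm q γ α (m, i) = (1 - q) * (1 - α)
      * (lam * (1 - γ) * γ ^ (m - 1) / (mu * (1 - pgf b p γ))) * (q * α) ^ i := by
  obtain ⟨m, rfl⟩ := Nat.exists_eq_add_of_le' hm
  have hpgf : 1 - pgf b p γ ≠ 0 := (sub_pos.2 (pgf_lt_one hp hp1 h.pos.le h.lt_one)).ne'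
  have hratio : γ ^ (m + 1)
      = (1 - q) * (lam * (1 - γ) * γ ^ m / (mu * (1 - pgf b p γ))) := by
    rw [← mul_div_assoc, eq_div_iff (mul_ne_zero hmu hpgf)]
    linear_combination γ ^ m * (1 - γ) * h.mul_tailPgf hp1
      - γ ^ m * mu * γ * one_sub_mul_tailPgf hp1 γ
  rw [productForm_succ, hratio, Nat.add_sub_cancel]
  ring

end IsFactorPair

theorem one_add_sum_Icc_pow (x : ℝ) (n : ℕ) :
    1 + ∑ k ∈ Finset.Icc 1 n, x ^ k = ∑ k ∈ Finset.range (n + 1), x ^ k := by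
  rw [Finset.range_eq_Ico, Finset.sum_eq_sum_Ico_succ_bot n.succ_pos, pow_zero]
  rfl

end ProductForm

end CoxQueue

end

theorem mainTheorem8 (lam mu q : ℝ) (b : ℕ) (p : ℕ → ℝ)
    (hlam : 0 < lam) (hmu : 0 < mu) (hq0 : 0 < q) (hq1 : q < 1)
    (hp : ∀ j ∈ Finset.Icc 1 b, 0 ≤ p j) (hp1 : ∑ j ∈ Finset.Icc 1 b, p j = 1)
    (herg : lam * (1 - q) < mu * CoxQueue.meanBatch b p) :
    ∃ γ α : ℝ,
      CoxQueue.IsFactorPair lam mu q b p γ α ∧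
      (∀ γ' α' : ℝ, CoxQueue.IsFactorPair lam mu q b p γ' α' → γ' = γ ∧ α' = α) ∧
      ∃ π : CoxQueue.State → ℝ,
        CoxQueue.IsStationary lam mu q b p π ∧
        (∀ π' : CoxQueue.State → ℝ, CoxQueue.IsStationary lam mu q b p π' → π' = π) ∧
        (∀ m i : ℕ, 1 ≤ m →
          π (m, i) = π (0, 0) * (lam * (1 - γ) * γ ^ (m - 1) / (mu * (1 - CoxQueue.pgf b p γ)))
            * ∏ _l ∈ Finset.Icc 1 i, (q * α)) ∧
        (∀ i : ℕ, 1 ≤ i →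
          π (0, i) = π (0, 0) * q ^ i * (1 + ∑ j ∈ Finset.Icc 1 i, α ^ j)) ∧
        π (0, 0) = (1 - q) * (1 - α) := by
  obtain ⟨γ, α, h⟩ := CoxQueue.exists_isFactorPair hlam hmu hq0.le hq1 hp hp1 herg
  have hstat := h.isStationary_productForm hq0.le hq1 hp1
  refine ⟨γ, α, h, fun γ' α' h' => h'.unique hmu hq0.le hq1 hp hp1 h,
    CoxQueue.productForm q γ α, hstat, fun π' h' => h'.unique hlam hmu hq0.le hq1 hp hp1 hstat,
    fun m i hm => ?_, fun i _ => ?_, CoxQueue.productForm_zero_zero⟩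
  · rw [CoxQueue.productForm_zero_zero, h.productForm_of_pos hmu.ne' hp hp1 hm,
      Finset.prod_const, Nat.card_Icc, Nat.add_sub_cancel]
  · rw [CoxQueue.productForm_zero_zero, CoxQueue.productForm_zero_eq_geom_sum,
      CoxQueue.one_add_sum_Icc_pow]
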